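/- For independent real random variables $X_1,X_2,Z_1,Z_2$ with $Z_i\sim\mathcal N(0,N_i)$, consider the objective (with $h$ the differential entropy in nats) $$F(P_{X_1},P_{X_2})=u\,h(X_1+X_2+Z_1+Z_2)+h(X_1+Z_1)-(1+u)\,h(X_1+Z_1+Z_2)-\Sigma_1\,\mathbb E[X_1^2],$$ to be maximized over all laws $P_{X_1},P_{X_2}$ on $\mathbb R$ with $\mathbb E[X_2^2]\le A_2$; when $\Sigma_1>0$, $F$ is read as $-\infty$ if $\mathbb E[X_1^2]=\infty$. (A conjecture of Costa, Nair, Ng and Wang states that the maximum is attained by Gaussian $X_1$ and $X_2$.) Theorem. Let $u=N_1=1$. There exist $N_2=A_2>0$ and $\Sigma_1>0$ such that $$\sup\{F(P_{X_1},P_{X_2}) : \mathbb E[X_2^2]\le A_2\}>0,$$ while the supremum of $F$ restricted to Gaussian $X_2$ (with $\mathbb E[X_2^2]\le A_2$, arbitrary mean, possibly degenerate) and arbitrary $X_1$ is at most $0$. In particular, for these parameters no pair of Gaussian laws attains the maximum, so the conjecture fails with strictly positive $N_1$ and $\Sigma_1$. -/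

import Mathlib

open MeasureTheory ProbabilityTheory
open scoped ENNReal NNReal

noncomputable section

/-- The differential entropy `h(μ) = -∫ f log f` (in nats) of a probability measure `μ` on `ℝ` with
Lebesgue density `f`, as an extended real: the integral of the positive part of `-f log f` minus
the integral of its negative part. It is `-∞` if `μ` has no density. (The difference `∞ - ∞` is
`-∞` in `EReal`; it does not occur for a bounded density, where the second integral is finite.) -/
def differentialEntropy (μ : Measure ℝ) : EReal :=
  open Classical in
  if μ ≪ volume then
    ((∫⁻ x, ENNReal.ofReal (Real.negMulLog (μ.rnDeriv volume x).toReal) : ℝ≥0∞) : EReal)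
      - ((∫⁻ x, ENNReal.ofReal (-Real.negMulLog (μ.rnDeriv volume x).toReal) : ℝ≥0∞) : EReal)
  else ⊥

/-- The second moment `E[X²] ∈ [0, ∞]` of a random variable `X` with law `μ`. -/
def secondMoment (μ : Measure ℝ) : ℝ≥0∞ := ∫⁻ x, ENNReal.ofReal (x ^ 2) ∂μ

/-- The objective
`u h(X₁+X₂+Z₁+Z₂) + h(X₁+Z₁) - (1+u) h(X₁+Z₁+Z₂) - S₁ E[X₁²]`
in dimension one, as a function of the pair `P` of the laws of `X₁` and `X₂`, where `Z₁ ∼ N(0,N₁)`,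
`Z₂ ∼ N(0,N₂)` and `X₁, X₂, Z₁, Z₂` are independent, so that the laws of the sums are
convolutions. If `N₁, S₁ > 0` and `E[X₁²] = ∞`, the value is `-∞`. -/
def zObjective (u N₁ N₂ S₁ : ℝ≥0) (P : Measure ℝ × Measure ℝ) : EReal :=
  ((u : ℝ) : EReal) *
      differentialEntropy (P.1.conv (P.2.conv ((gaussianReal 0 N₁).conv (gaussianReal 0 N₂))))
    + differentialEntropy (P.1.conv (gaussianReal 0 N₁))
    - ((1 + u : ℝ) : EReal) *
      differentialEntropy (P.1.conv ((gaussianReal 0 N₁).conv (gaussianReal 0 N₂)))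
    - ((S₁ : ℝ) : EReal) * (secondMoment P.1 : EReal)

/-- The admissible pairs of input laws: probability laws of `X₁` and `X₂` with `E[X₂²] ≤ A₂`. -/
def zFeasible (A₂ : ℝ≥0) : Set (Measure ℝ × Measure ℝ) :=
  {P | IsProbabilityMeasure P.1 ∧ IsProbabilityMeasure P.2 ∧ secondMoment P.2 ≤ (A₂ : ℝ≥0∞)}

end

/-!
If `X₂` is Gaussian with `E[X₂²] ≤ A₂ = N₂`, then `Z₂` has the law of `X₂ + W` with an independent
Gaussian `W`. With `Z₁` as background noise, the inequality `h(X₁ + A + B) + h(X₁) ≤ h(X₁ + A) +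
h(X₁ + B)`, which is the data-processing inequality for relative entropy in disguise, together with
the monotonicity of `h` under adding independent variables gives `F ≤ 0` for `u ≤ 1`.

A positive value comes from `X₂` and `Z₂` of size `ε`, with `X₂` centred, of the same variance as
`Z₂` but skewed. Let `L` be the logarithm of the density of `X₁ + Z₁`. Expanding the cross entropies
`-E[L(X₁ + Z₁ + X₂ + Z₂)]` and `-E[L(X₁ + Z₁ + Z₂)]` to third order in `ε`, the second-order terms
cancel because `u Var(X₂ + Z₂) = (1 + u) Var(Z₂)`, and what remains is
`-u E[X₂³] E[L‴(X₁ + Z₁)] / 6`. This is positive and of order `ε³` when `X₂` has negative skewness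
and `X₁` is a rare spike, since `L‴(X₁ + Z₁)` then has positive mean. Passing from entropies to
cross entropies costs a relative entropy, which is at most the `χ²`-divergence of `X₂ + Z₂ + Z₁`
from `Z₁` and hence `O(ε⁴)`. A small enough power price `Σ₁` keeps the value positive.
-/

open InformationTheory

section Densities

variable {Ω : Type*} [MeasurableSpace Ω]

lemma integral_le_of_lintegral_exp_le {μ : Measure Ω} [IsProbabilityMeasure μ] {f : Ω → ℝ}
    (hf : Integrable f μ) {C : ℝ} (hC : 0 ≤ C)
    (h : ∫⁻ x, ENNReal.ofReal (Real.exp (f x)) ∂μ ≤ ENNReal.ofReal (1 + C)) :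
    ∫ x, f x ∂μ ≤ C := by
  have hexp : Integrable (fun x ↦ Real.exp (f x)) μ :=
    ⟨(Real.continuous_exp.comp_aestronglyMeasurable hf.1), by
      rw [hasFiniteIntegral_iff_ofReal (ae_of_all _ fun x ↦ (Real.exp_pos _).le)]
      exact h.trans_lt ENNReal.ofReal_lt_top⟩
  have hle : ∫ x, (f x + 1) ∂μ ≤ 1 + C := by
    rw [← ENNReal.ofReal_le_ofReal_iff (by positivity)]
    refine le_trans (ENNReal.ofReal_le_ofReal (integral_mono (hf.add (integrable_const 1)) hexp
      fun x ↦ Real.add_one_le_exp (f x))) ?_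
    rwa [ofReal_integral_eq_lintegral_ofReal hexp (ae_of_all _ fun x ↦ (Real.exp_pos _).le)]
  rw [integral_add hf (integrable_const 1)] at hle
  simp only [integral_const, probReal_univ, smul_eq_mul, mul_one] at hle
  linarith

lemma llr_withDensity_ofReal {μ : Measure Ω} [SigmaFinite μ] {f g : Ω → ℝ} (hf : Measurable f)
    (hg : Measurable g) (hf0 : ∀ x, 0 < f x) (hg0 : ∀ x, 0 < g x) :
    llr (μ.withDensity fun x ↦ ENNReal.ofReal (f x)) (μ.withDensity fun x ↦ ENNReal.ofReal (g x))
      =ᵐ[μ] fun x ↦ Real.log (f x) - Real.log (g x) := by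
  have hfm : Measurable fun x ↦ ENNReal.ofReal (f x) := by fun_prop
  have hgm : Measurable fun x ↦ ENNReal.ofReal (g x) := by fun_prop
  have : SigmaFinite (μ.withDensity fun x ↦ ENNReal.ofReal (f x)) :=
    SigmaFinite.withDensity_ofReal f
  have : SigmaFinite (μ.withDensity fun x ↦ ENNReal.ofReal (g x)) :=
    SigmaFinite.withDensity_ofReal g
  have hac : μ ≪ μ.withDensity fun x ↦ ENNReal.ofReal (g x) :=
    withDensity_absolutelyContinuous' hgm.aemeasurable
      (ae_of_all _ fun x ↦ (ENNReal.ofReal_pos.2 (hg0 x)).ne')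
  filter_upwards [hac.ae_le (Measure.rnDeriv_eq_div (withDensity_absolutelyContinuous μ
      fun x ↦ ENNReal.ofReal (f x)) (withDensity_absolutelyContinuous μ _)),
    Measure.rnDeriv_withDensity μ hfm, Measure.rnDeriv_withDensity μ hgm] with x hx hxf hxg
  rw [llr, hx, hxf, hxg, ENNReal.toReal_div, ENNReal.toReal_ofReal (hf0 x).le,
    ENNReal.toReal_ofReal (hg0 x).le, Real.log_div (hf0 x).ne' (hg0 x).ne']

lemma differentialEntropy_withDensity {f : ℝ → ℝ} (hf : Measurable f) (hf0 : ∀ x, 0 ≤ f x)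
    (hint : Integrable (fun x ↦ Real.negMulLog (f x))) :
    differentialEntropy (volume.withDensity fun x ↦ ENNReal.ofReal (f x)) =
      (∫ x, Real.negMulLog (f x) : ℝ) := by
  have hrn : (fun x ↦ ((volume.withDensity fun x ↦ ENNReal.ofReal (f x)).rnDeriv volume x).toReal)
      =ᵐ[volume] f := by
    filter_upwards [Measure.rnDeriv_withDensity volume hf.ennreal_ofReal] with x hx
    rw [hx, ENNReal.toReal_ofReal (hf0 x)]
  have hpos : ∫⁻ x, ENNReal.ofReal (Real.negMulLog (f x)) ≠ ∞ := hint.lintegral_lt_top.ne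
  have hneg : ∫⁻ x, ENNReal.ofReal (-Real.negMulLog (f x)) ≠ ∞ := hint.neg.lintegral_lt_top.ne
  rw [differentialEntropy, if_pos (withDensity_absolutelyContinuous _ _),
    integral_eq_lintegral_pos_part_sub_lintegral_neg_part hint, EReal.coe_sub,
    EReal.coe_ennreal_toReal hpos, EReal.coe_ennreal_toReal hneg]
  congr 2 <;> refine lintegral_congr_ae ?_ <;> filter_upwards [hrn] with x hx <;> rw [hx]

end Densities

section Convolution

lemma conv_right_comm {M : Type*} [AddCommMonoid M] [MeasurableSpace M] [MeasurableAdd₂ M]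
    (μ ν ξ : Measure M) [SFinite ν] [SFinite ξ] : (μ ∗ ν) ∗ ξ = (μ ∗ ξ) ∗ ν := by
  rw [Measure.conv_assoc, Measure.conv_comm ν ξ, ← Measure.conv_assoc]

lemma conv_withDensity {G : Type*} [AddCommGroup G] [MeasurableSpace G] [MeasurableAdd₂ G]
    [MeasurableNeg G] {ρ μ : Measure G} [SFinite ρ] [SFinite μ] [μ.IsAddLeftInvariant]
    {f : G → ℝ≥0∞} (hf : Measurable f) :
    ρ ∗ μ.withDensity f = μ.withDensity fun y ↦ ∫⁻ x, f (y - x) ∂ρ := by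
  have : MeasurableSub₂ G := inferInstance
  have hfs : Measurable fun p : G × G ↦ f (p.1 - p.2) := by fun_prop
  refine Measure.ext_of_lintegral _ fun g hg ↦ ?_
  calc ∫⁻ y, g y ∂(ρ ∗ μ.withDensity f)
      = ∫⁻ x, ∫⁻ y, f y * g (x + y) ∂μ ∂ρ := by
        rw [Measure.lintegral_conv hg]
        refine lintegral_congr fun x ↦ ?_
        exact lintegral_withDensity_eq_lintegral_mul _ hf (hg.comp (measurable_const_add x))
    _ = ∫⁻ x, ∫⁻ y, f (y - x) * g y ∂μ ∂ρ := by
        refine lintegral_congr fun x ↦ ?_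
        rw [← lintegral_add_left_eq_self (fun y ↦ f (y - x) * g y) x]
        simp only [add_sub_cancel_left]
    _ = ∫⁻ y, ∫⁻ x, f (y - x) * g y ∂ρ ∂μ := lintegral_lintegral_swap (by fun_prop)
    _ = ∫⁻ y, g y ∂μ.withDensity fun y ↦ ∫⁻ x, f (y - x) ∂ρ := by
        rw [lintegral_withDensity_eq_lintegral_mul _ hfs.lintegral_prod_right' hg]
        exact lintegral_congr fun y ↦ lintegral_mul_const _ (by fun_prop)

lemma memLp_id_conv {M : Type*} [NormedAddCommGroup M] [MeasurableSpace M] [BorelSpace M]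
    [SecondCountableTopology M] {μ ν : Measure M} [IsFiniteMeasure μ] [IsFiniteMeasure ν]
    {p : ℝ≥0∞} (hμ : MemLp id p μ) (hν : MemLp id p ν) : MemLp id p (μ ∗ ν) := by
  rw [Measure.conv, memLp_map_measure_iff (by fun_prop) (by fun_prop)]
  exact (hμ.comp_fst ν).add (hν.comp_snd μ)

lemma memLp_id_map_const_mul {p : ℝ≥0∞} {μ : Measure ℝ} (hμ : MemLp id p μ) (c : ℝ) :
    MemLp id p (μ.map (c * ·)) :=
  (memLp_map_measure_iff (by fun_prop) (by fun_prop)).2 (hμ.const_mul c)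

lemma memLp_id_dirac {M : Type*} [NormedAddCommGroup M] [MeasurableSpace M] [BorelSpace M]
    [SecondCountableTopology M] (x : M) (p : ℝ≥0∞) : MemLp id p (Measure.dirac x) :=
  (memLp_const x).congr_norm (by fun_prop) (by simp)

lemma klDiv_conv_le {M : Type*} [AddMonoid M] [MeasurableSpace M] [MeasurableAdd₂ M]
    (μ ν ξ : Measure M) [IsFiniteMeasure μ] [IsFiniteMeasure ν] [IsProbabilityMeasure ξ] :
    klDiv (μ ∗ ξ) (ν ∗ ξ) ≤ klDiv μ ν := by
  calc klDiv (μ ∗ ξ) (ν ∗ ξ) ≤ klDiv (μ.prod ξ) (ν.prod ξ) := klDiv_map_le _ _ measurable_add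
    _ = klDiv μ ν := by
      rw [← Measure.compProd_const, ← Measure.compProd_const, klDiv_compProd_left]

end Convolution

section GaussianSmoothing

/-- The Lebesgue density at `y` of `ρ ∗ gaussianReal 0 v`, the law of a `ρ`-distributed variable
with independent centred Gaussian noise of variance `v ≠ 0` added. -/
noncomputable def smoothedDensity (v : ℝ≥0) (ρ : Measure ℝ) (y : ℝ) : ℝ :=
  ∫ x, gaussianPDFReal 0 v (y - x) ∂ρ

/-- The logarithm of the density of `ρ ∗ gaussianReal 0 v`. -/
noncomputable def smoothedLogDensity (v : ℝ≥0) (ρ : Measure ℝ) (y : ℝ) : ℝ :=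
  Real.log (smoothedDensity v ρ y)

/-- The differential entropy of `ρ ∗ gaussianReal 0 v` as a real number, for `ρ` with finite second
moment and `v ≠ 0`. -/
noncomputable def smoothedEntropy (v : ℝ≥0) (ρ : Measure ℝ) : ℝ :=
  -∫ y, smoothedLogDensity v ρ y ∂(ρ ∗ gaussianReal 0 v)

lemma gaussianPDFReal_zero_le (v : ℝ≥0) (x : ℝ) :
    gaussianPDFReal 0 v x ≤ (√(2 * Real.pi * v))⁻¹ := by
  refine mul_le_of_le_one_right (by positivity) (Real.exp_le_one_iff.2 ?_)
  exact div_nonpos_of_nonpos_of_nonneg (by simp [sq_nonneg]) (by positivity)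

variable {v : ℝ≥0} {ρ τ : Measure ℝ}

@[fun_prop]
lemma measurable_smoothedDensity [SFinite ρ] : Measurable (smoothedDensity v ρ) :=
  (StronglyMeasurable.integral_prod_right'
    (f := fun p : ℝ × ℝ ↦ gaussianPDFReal 0 v (p.1 - p.2))
    ((measurable_gaussianPDFReal 0 v).comp (by fun_prop)).stronglyMeasurable).measurable

@[fun_prop]
lemma measurable_smoothedLogDensity [SFinite ρ] : Measurable (smoothedLogDensity v ρ) :=
  Real.measurable_log.comp measurable_smoothedDensity

lemma integrable_gaussianPDFReal_sub [IsFiniteMeasure ρ] (y : ℝ) :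
    Integrable (fun x ↦ gaussianPDFReal 0 v (y - x)) ρ :=
  (integrable_const (√(2 * Real.pi * v))⁻¹).mono'
    ((measurable_gaussianPDFReal 0 v).comp (by fun_prop)).aestronglyMeasurable
    (ae_of_all _ fun x ↦ by
      rw [Real.norm_of_nonneg (gaussianPDFReal_nonneg _ _ _)]
      exact gaussianPDFReal_zero_le v _)

variable [IsProbabilityMeasure ρ] [IsProbabilityMeasure τ]

lemma smoothedDensity_le (y : ℝ) : smoothedDensity v ρ y ≤ (√(2 * Real.pi * v))⁻¹ := by
  calc smoothedDensity v ρ y ≤ ∫ _, (√(2 * Real.pi * v))⁻¹ ∂ρ :=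
        integral_mono (integrable_gaussianPDFReal_sub y) (integrable_const _)
          fun x ↦ gaussianPDFReal_zero_le v (y - x)
    _ = (√(2 * Real.pi * v))⁻¹ := by simp

lemma ofReal_smoothedDensity (y : ℝ) :
    ENNReal.ofReal (smoothedDensity v ρ y) = ∫⁻ x, gaussianPDF 0 v (y - x) ∂ρ :=
  ofReal_integral_eq_lintegral_ofReal (integrable_gaussianPDFReal_sub y)
    (ae_of_all _ fun _ ↦ gaussianPDFReal_nonneg _ _ _)

lemma smoothedDensity_conv_dirac (b y : ℝ) :
    smoothedDensity v (ρ ∗ Measure.dirac b) y = smoothedDensity v ρ (y - b) := by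
  rw [Measure.conv_comm, smoothedDensity, integral_conv (integrable_gaussianPDFReal_sub y),
    integral_dirac]
  simp_rw [smoothedDensity, sub_add_eq_sub_sub]

lemma smoothedEntropy_conv_dirac (b : ℝ) :
    smoothedEntropy v (ρ ∗ Measure.dirac b) = smoothedEntropy v ρ := by
  rw [smoothedEntropy, conv_right_comm, Measure.conv_dirac,
    integral_map (by fun_prop) (by fun_prop)]
  simp_rw [smoothedLogDensity, smoothedDensity_conv_dirac, add_sub_cancel_right]
  rfl

variable [NeZero v]

lemma smoothedDensity_pos (y : ℝ) : 0 < smoothedDensity v ρ y := by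
  have hpos (x : ℝ) : 0 < gaussianPDFReal 0 v (y - x) := gaussianPDFReal_pos _ _ _ (NeZero.ne v)
  rw [smoothedDensity, integral_pos_iff_support_of_nonneg (fun x ↦ (hpos x).le)
    (integrable_gaussianPDFReal_sub y), Function.support_eq_univ fun x ↦ (hpos x).ne']
  simp

lemma conv_gaussianReal_eq_withDensity :
    ρ ∗ gaussianReal 0 v = volume.withDensity fun y ↦ ENNReal.ofReal (smoothedDensity v ρ y) := by
  rw [gaussianReal_of_var_ne_zero _ (NeZero.ne v), conv_withDensity (measurable_gaussianPDF 0 v)]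
  simp_rw [ofReal_smoothedDensity]

lemma smoothedLogDensity_le (y : ℝ) :
    smoothedLogDensity v ρ y ≤ -Real.log √(2 * Real.pi * v) := by
  rw [← Real.log_inv]
  exact Real.log_le_log (smoothedDensity_pos y) (smoothedDensity_le y)

lemma log_gaussianPDFReal (μ x : ℝ) :
    Real.log (gaussianPDFReal μ v x) = -Real.log √(2 * Real.pi * v) - (x - μ) ^ 2 / (2 * v) := by
  have hv : (0 : ℝ) < v := by exact_mod_cast NeZero.pos v
  rw [gaussianPDFReal, Real.log_mul (by positivity) (Real.exp_pos _).ne', Real.log_exp,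
    Real.log_inv]
  ring

lemma le_smoothedLogDensity (hρ : MemLp id 2 ρ) (y : ℝ) :
    -Real.log √(2 * Real.pi * v) - (y ^ 2 + ∫ x, x ^ 2 ∂ρ) / v ≤ smoothedLogDensity v ρ y := by
  have hv : (0 : ℝ) < v := by exact_mod_cast NeZero.pos v
  have hsq : Integrable (fun x ↦ x ^ 2) ρ := hρ.integrable_sq
  have hdiff : Integrable (fun x ↦ (y - x) ^ 2) ρ :=
    ((memLp_const y).sub hρ).integrable_sq
  have hlog : Integrable (fun x ↦ Real.log (gaussianPDFReal 0 v (y - x))) ρ := by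
    simp_rw [log_gaussianPDFReal, sub_zero]
    exact (integrable_const _).sub (hdiff.div_const _)
  have hexp (x : ℝ) : Real.exp (Real.log (gaussianPDFReal 0 v (y - x))) =
      gaussianPDFReal 0 v (y - x) := Real.exp_log (gaussianPDFReal_pos _ _ _ (NeZero.ne v))
  have hquad : Integrable (fun x ↦ (y ^ 2 + x ^ 2) / v) ρ :=
    ((integrable_const _).add hsq).div_const _
  have hjensen := convexOn_exp.map_integral_le Real.continuous_exp.continuousOn isClosed_univ
    (ae_of_all ρ fun _ ↦ Set.mem_univ _) hlog
    (by simpa only [Function.comp_def, hexp] using integrable_gaussianPDFReal_sub y)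
  simp_rw [hexp] at hjensen
  refine le_trans ?_ ((Real.le_log_iff_exp_le (smoothedDensity_pos y)).2 hjensen)
  calc -Real.log √(2 * Real.pi * v) - (y ^ 2 + ∫ x, x ^ 2 ∂ρ) / v
      = ∫ x, (-Real.log √(2 * Real.pi * v) - (y ^ 2 + x ^ 2) / v) ∂ρ := by
        rw [integral_sub (integrable_const _) hquad, integral_div,
          integral_add (integrable_const _) hsq]
        simp
    _ ≤ ∫ x, Real.log (gaussianPDFReal 0 v (y - x)) ∂ρ := by
        refine integral_mono ((integrable_const _).sub hquad) hlog fun x ↦ ?_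
        rw [log_gaussianPDFReal, sub_zero, ← mul_div_mul_left (y ^ 2 + x ^ 2) _ two_ne_zero]
        gcongr
        nlinarith [sq_nonneg (y + x)]

lemma integrable_smoothedLogDensity (hρ : MemLp id 2 ρ) {μ : Measure ℝ} [IsFiniteMeasure μ]
    (hμ : MemLp id 2 μ) : Integrable (smoothedLogDensity v ρ) μ := by
  have hlower : Integrable
      (fun y ↦ -Real.log √(2 * Real.pi * v) - (y ^ 2 + ∫ x, x ^ 2 ∂ρ) / v) μ :=
    (integrable_const _).sub ((hμ.integrable_sq.add (integrable_const _)).div_const _)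
  exact integrable_of_le_of_le (by fun_prop) (ae_of_all _ (le_smoothedLogDensity hρ))
    (ae_of_all _ smoothedLogDensity_le) hlower (integrable_const _)

lemma memLp_two_conv_gaussianReal (hρ : MemLp id 2 ρ) (m : ℝ) (w : ℝ≥0) :
    MemLp id 2 (ρ ∗ gaussianReal m w) :=
  memLp_id_conv hρ (memLp_id_gaussianReal 2)

lemma differentialEntropy_conv_gaussianReal (hρ : MemLp id 2 ρ) :
    differentialEntropy (ρ ∗ gaussianReal 0 v) = (smoothedEntropy v ρ : EReal) := by
  have hp0 (y : ℝ) := (smoothedDensity_pos (v := v) (ρ := ρ) y).le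
  have hmul (y : ℝ) : smoothedDensity v ρ y * smoothedLogDensity v ρ y =
      -Real.negMulLog (smoothedDensity v ρ y) := by
    simp [smoothedLogDensity, Real.negMulLog]
  have hint := integrable_smoothedLogDensity (v := v) hρ (memLp_two_conv_gaussianReal hρ 0 v)
  rw [conv_gaussianReal_eq_withDensity, integrable_withDensity_iff_integrable_smul₀'
    (by fun_prop) (ae_of_all _ fun _ ↦ ENNReal.ofReal_lt_top)] at hint
  simp_rw [ENNReal.toReal_ofReal (hp0 _), smul_eq_mul, hmul] at hint
  rw [smoothedEntropy, conv_gaussianReal_eq_withDensity,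
    integral_withDensity_eq_integral_toReal_smul
    (by fun_prop) (ae_of_all _ fun _ ↦ ENNReal.ofReal_lt_top),
    differentialEntropy_withDensity measurable_smoothedDensity hp0 (integrable_neg_iff.1 hint)]
  simp_rw [ENNReal.toReal_ofReal (hp0 _), smul_eq_mul, hmul, integral_neg, neg_neg]

lemma conv_gaussianReal_absolutelyContinuous :
    τ ∗ gaussianReal 0 v ≪ ρ ∗ gaussianReal 0 v := by
  rw [conv_gaussianReal_eq_withDensity, conv_gaussianReal_eq_withDensity]
  exact (withDensity_absolutelyContinuous _ _).trans (withDensity_absolutelyContinuous'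
    (by fun_prop) (ae_of_all _ fun y ↦ (ENNReal.ofReal_pos.2 (smoothedDensity_pos y)).ne'))

lemma llr_conv_gaussianReal :
    llr (τ ∗ gaussianReal 0 v) (ρ ∗ gaussianReal 0 v) =ᵐ[τ ∗ gaussianReal 0 v]
      fun y ↦ smoothedLogDensity v τ y - smoothedLogDensity v ρ y := by
  rw [conv_gaussianReal_eq_withDensity, conv_gaussianReal_eq_withDensity]
  exact (withDensity_absolutelyContinuous _ _).ae_le (llr_withDensity_ofReal
    measurable_smoothedDensity measurable_smoothedDensity smoothedDensity_pos smoothedDensity_pos)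

lemma klDiv_conv_gaussianReal_ne_top (hτ : MemLp id 2 τ) (hρ : MemLp id 2 ρ) :
    klDiv (τ ∗ gaussianReal 0 v) (ρ ∗ gaussianReal 0 v) ≠ ∞ := by
  have h2 := memLp_two_conv_gaussianReal hτ 0 v
  exact klDiv_ne_top conv_gaussianReal_absolutelyContinuous
    (((integrable_smoothedLogDensity hτ h2).sub
      (integrable_smoothedLogDensity hρ h2)).congr llr_conv_gaussianReal.symm)

lemma toReal_klDiv_conv_gaussianReal :
    (klDiv (τ ∗ gaussianReal 0 v) (ρ ∗ gaussianReal 0 v)).toReal =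
      ∫ y, (smoothedLogDensity v τ y - smoothedLogDensity v ρ y) ∂(τ ∗ gaussianReal 0 v) := by
  rw [toReal_klDiv_of_measure_eq conv_gaussianReal_absolutelyContinuous (by simp),
    integral_congr_ae llr_conv_gaussianReal]

lemma toReal_klDiv_conv_gaussianReal_eq_sub (hτ : MemLp id 2 τ) (hρ : MemLp id 2 ρ) :
    (klDiv (τ ∗ gaussianReal 0 v) (ρ ∗ gaussianReal 0 v)).toReal =
      -∫ y, smoothedLogDensity v ρ y ∂(τ ∗ gaussianReal 0 v) - smoothedEntropy v τ := by
  have h2 := memLp_two_conv_gaussianReal hτ 0 v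
  rw [toReal_klDiv_conv_gaussianReal, integral_sub (integrable_smoothedLogDensity hτ h2)
    (integrable_smoothedLogDensity hρ h2), smoothedEntropy]
  ring

lemma smoothedEntropy_le_neg_integral_smoothedLogDensity (hτ : MemLp id 2 τ) (hρ : MemLp id 2 ρ) :
    smoothedEntropy v τ ≤ -∫ y, smoothedLogDensity v ρ y ∂(τ ∗ gaussianReal 0 v) := by
  rw [← sub_nonneg, ← toReal_klDiv_conv_gaussianReal_eq_sub hτ hρ]
  exact ENNReal.toReal_nonneg

lemma toReal_klDiv_conv_dirac (hρ : MemLp id 2 ρ) (hτ : MemLp id 2 τ) (b : ℝ) :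
    (klDiv ((ρ ∗ Measure.dirac b) ∗ gaussianReal 0 v) ((ρ ∗ τ) ∗ gaussianReal 0 v)).toReal =
      -∫ y, smoothedLogDensity v (ρ ∗ τ) (b + y) ∂(ρ ∗ gaussianReal 0 v) -
        smoothedEntropy v ρ := by
  rw [toReal_klDiv_conv_gaussianReal_eq_sub (memLp_id_conv hρ (memLp_id_dirac b 2))
      (memLp_id_conv hρ hτ),
    smoothedEntropy_conv_dirac, Measure.conv_comm ρ, Measure.conv_assoc, Measure.dirac_conv,
    integral_map (by fun_prop) (by fun_prop)]

lemma integrable_smoothedLogDensity_conv (hρ : MemLp id 2 ρ) (hτ : MemLp id 2 τ) :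
    Integrable (smoothedLogDensity v (ρ ∗ τ)) (τ ∗ ρ ∗ gaussianReal 0 v) :=
  integrable_smoothedLogDensity (memLp_id_conv hρ hτ)
    (memLp_id_conv hτ (memLp_two_conv_gaussianReal hρ 0 v))

lemma integrable_integral_smoothedLogDensity_add (hρ : MemLp id 2 ρ) (hτ : MemLp id 2 τ) :
    Integrable (fun b ↦ ∫ y, smoothedLogDensity v (ρ ∗ τ) (b + y) ∂(ρ ∗ gaussianReal 0 v)) τ := by
  have hint : Integrable (smoothedLogDensity v (ρ ∗ τ))
      ((τ.prod (ρ ∗ gaussianReal 0 v)).map fun p ↦ p.1 + p.2) :=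
    integrable_smoothedLogDensity_conv hρ hτ
  rw [integrable_map_measure (by fun_prop) (by fun_prop)] at hint
  exact hint.integral_prod_left

lemma integrable_toReal_klDiv_conv_dirac (hρ : MemLp id 2 ρ) (hτ : MemLp id 2 τ) :
    Integrable (fun b ↦ (klDiv ((ρ ∗ Measure.dirac b) ∗ gaussianReal 0 v)
      ((ρ ∗ τ) ∗ gaussianReal 0 v)).toReal) τ := by
  simp_rw [toReal_klDiv_conv_dirac hρ hτ]
  exact (integrable_integral_smoothedLogDensity_add hρ hτ).neg.sub (integrable_const _)

-- Both sides are the mutual information of `τ` and the output of the channel with noise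
-- `ρ ∗ gaussianReal 0 v`.
lemma smoothedEntropy_conv_sub_eq_integral_klDiv (hρ : MemLp id 2 ρ) (hτ : MemLp id 2 τ) :
    smoothedEntropy v (ρ ∗ τ) - smoothedEntropy v ρ =
      ∫ b, (klDiv ((ρ ∗ Measure.dirac b) ∗ gaussianReal 0 v)
        ((ρ ∗ τ) ∗ gaussianReal 0 v)).toReal ∂τ := by
  have hentropy : smoothedEntropy v (ρ ∗ τ) =
      -∫ b, ∫ y, smoothedLogDensity v (ρ ∗ τ) (b + y) ∂(ρ ∗ gaussianReal 0 v) ∂τ := by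
    rw [← integral_conv (integrable_smoothedLogDensity_conv hρ hτ), ← Measure.conv_assoc,
      Measure.conv_comm τ, smoothedEntropy]
  simp_rw [toReal_klDiv_conv_dirac hρ hτ]
  rw [integral_sub (integrable_integral_smoothedLogDensity_add hρ hτ).fun_neg (integrable_const _),
    integral_neg, hentropy]
  simp

lemma smoothedEntropy_le_smoothedEntropy_conv (hρ : MemLp id 2 ρ) (hτ : MemLp id 2 τ) :
    smoothedEntropy v ρ ≤ smoothedEntropy v (ρ ∗ τ) := by
  rw [← sub_nonneg, smoothedEntropy_conv_sub_eq_integral_klDiv hρ hτ]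
  exact integral_nonneg fun b ↦ ENNReal.toReal_nonneg

-- Convolving with `α` is a Markov kernel, so by data processing it decreases each of the relative
-- entropies whose average is the entropy increment due to `β`.
lemma smoothedEntropy_conv_conv_add_le {α β : Measure ℝ} [IsProbabilityMeasure α]
    [IsProbabilityMeasure β] (hρ : MemLp id 2 ρ) (hα : MemLp id 2 α) (hβ : MemLp id 2 β) :
    smoothedEntropy v ((ρ ∗ α) ∗ β) + smoothedEntropy v ρ ≤
      smoothedEntropy v (ρ ∗ α) + smoothedEntropy v (ρ ∗ β) := by
  have hρα := memLp_id_conv hρ hα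
  have hmono : smoothedEntropy v ((ρ ∗ α) ∗ β) - smoothedEntropy v (ρ ∗ α) ≤
      smoothedEntropy v (ρ ∗ β) - smoothedEntropy v ρ := by
    rw [smoothedEntropy_conv_sub_eq_integral_klDiv hρα hβ,
      smoothedEntropy_conv_sub_eq_integral_klDiv hρ hβ]
    refine integral_mono (integrable_toReal_klDiv_conv_dirac hρα hβ)
      (integrable_toReal_klDiv_conv_dirac hρ hβ) fun b ↦ ENNReal.toReal_mono ?_ ?_
    · exact klDiv_conv_gaussianReal_ne_top
        (memLp_id_conv hρ (memLp_id_dirac b 2)) (memLp_id_conv hρ hβ)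
    · rw [conv_right_comm ρ α, conv_right_comm (ρ ∗ Measure.dirac b), conv_right_comm ρ α,
        conv_right_comm (ρ ∗ β)]
      exact klDiv_conv_le _ _ _
  linarith

end GaussianSmoothing

section SubGaussian

lemma exp_le_one_add_add_sq_mul_exp_abs (x : ℝ) :
    Real.exp x ≤ 1 + x + x ^ 2 * Real.exp |x| := by
  have h := Complex.norm_exp_sub_sum_le_norm_mul_exp (x : ℂ) 2
  have hcast : Complex.exp x - ∑ m ∈ Finset.range 2, (x : ℂ) ^ m / m.factorial =
      ((Real.exp x - (1 + x) : ℝ) : ℂ) := by simp [Finset.sum_range_succ]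
  rw [hcast, Complex.norm_real, Complex.norm_real, Real.norm_eq_abs, Real.norm_eq_abs, sq_abs] at h
  linarith [le_abs_self (Real.exp x - (1 + x))]

variable {α : Measure ℝ} {c : ℝ}

lemma memLp_id_of_integrable_exp_mul_sq (hc : 0 < c)
    (h : Integrable (fun x ↦ Real.exp (c * x ^ 2)) α) (p : ℝ≥0) : MemLp id p α := by
  have hset : integrableExpSet id α = Set.univ := by
    refine Set.eq_univ_of_forall fun t ↦ ?_
    refine (h.const_mul (Real.exp (t ^ 2 / (4 * c)))).mono' (by fun_prop) (ae_of_all _ fun x ↦ ?_)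
    rw [Real.norm_of_nonneg (Real.exp_pos _).le, ← Real.exp_add, Real.exp_le_exp, id,
      ← sub_nonneg]
    have hsq : t ^ 2 / (4 * c) + c * x ^ 2 - t * x = (t - 2 * c * x) ^ 2 / (4 * c) := by
      field_simp
      ring
    rw [hsq]
    positivity
  exact memLp_of_mem_interior_integrableExpSet (by simp [hset]) p

lemma integrable_sq_mul_exp_mul_sq (hc : 0 < c)
    (h : Integrable (fun x ↦ Real.exp (c * x ^ 2)) α) :
    Integrable (fun x ↦ x ^ 2 * Real.exp (c / 2 * x ^ 2)) α := by
  refine (h.const_mul (2 / c)).mono' (by fun_prop) (ae_of_all _ fun x ↦ ?_)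
  have hexp : x ^ 2 ≤ 2 / c * Real.exp (c / 2 * x ^ 2) := by
    have := Real.add_one_le_exp (c / 2 * x ^ 2)
    calc x ^ 2 = 2 / c * (c / 2 * x ^ 2) := by field_simp
      _ ≤ 2 / c * Real.exp (c / 2 * x ^ 2) := by gcongr; linarith
  rw [Real.norm_of_nonneg (by positivity)]
  calc x ^ 2 * Real.exp (c / 2 * x ^ 2)
      ≤ 2 / c * Real.exp (c / 2 * x ^ 2) * Real.exp (c / 2 * x ^ 2) := by gcongr
    _ = 2 / c * Real.exp (c * x ^ 2) := by rw [mul_assoc, ← Real.exp_add]; ring_nf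

lemma exp_mul_mul_le {t : ℝ} (ht : |t| ≤ c) (x y : ℝ) :
    Real.exp (t * (x * y)) ≤ 1 + t * (x * y) +
      t ^ 2 * ((x ^ 2 * Real.exp (c / 2 * x ^ 2)) * (y ^ 2 * Real.exp (c / 2 * y ^ 2))) := by
  have hxy : |t * (x * y)| ≤ c / 2 * x ^ 2 + c / 2 * y ^ 2 := by
    have hamgm := two_mul_le_add_sq |x| |y|
    rw [sq_abs, sq_abs] at hamgm
    calc |t * (x * y)| ≤ c * (|x| * |y|) := by rw [abs_mul, abs_mul]; gcongr
      _ ≤ c / 2 * x ^ 2 + c / 2 * y ^ 2 := by nlinarith [(abs_nonneg t).trans ht]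
  calc Real.exp (t * (x * y))
      ≤ 1 + t * (x * y) + (t * (x * y)) ^ 2 * Real.exp |t * (x * y)| :=
        exp_le_one_add_add_sq_mul_exp_abs _
    _ ≤ 1 + t * (x * y) +
        (t * (x * y)) ^ 2 * Real.exp (c / 2 * x ^ 2 + c / 2 * y ^ 2) := by gcongr
    _ = _ := by rw [Real.exp_add]; ring

lemma lintegral_lintegral_exp_mul_le [IsProbabilityMeasure α] (hc : 0 < c)
    (h : Integrable (fun x ↦ Real.exp (c * x ^ 2)) α) (hmean : ∫ x, x ∂α = 0) {t : ℝ}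
    (ht : |t| ≤ c) :
    ∫⁻ x, ∫⁻ y, ENNReal.ofReal (Real.exp (t * (x * y))) ∂α ∂α ≤
      ENNReal.ofReal (1 + (t * ∫ x, x ^ 2 * Real.exp (c / 2 * x ^ 2) ∂α) ^ 2) := by
  set w : ℝ → ℝ := fun x ↦ x ^ 2 * Real.exp (c / 2 * x ^ 2)
  have hid : Integrable (fun x ↦ x) α :=
    (memLp_id_of_integrable_exp_mul_sq hc h 1).integrable le_rfl
  have hw : Integrable w α := integrable_sq_mul_exp_mul_sq hc h
  have hlin : Integrable (fun p : ℝ × ℝ ↦ 1 + t * (p.1 * p.2)) (α.prod α) :=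
    (integrable_const _).add ((hid.mul_prod hid).const_mul _)
  have hquad : Integrable (fun p : ℝ × ℝ ↦ t ^ 2 * (w p.1 * w p.2)) (α.prod α) :=
    (hw.mul_prod hw).const_mul _
  have hle (p : ℝ × ℝ) : Real.exp (t * (p.1 * p.2)) ≤
      1 + t * (p.1 * p.2) + t ^ 2 * (w p.1 * w p.2) := exp_mul_mul_le ht p.1 p.2
  rw [← lintegral_prod (fun p : ℝ × ℝ ↦ ENNReal.ofReal (Real.exp (t * (p.1 * p.2))))
    (by fun_prop)]
  calc ∫⁻ p, ENNReal.ofReal (Real.exp (t * (p.1 * p.2))) ∂(α.prod α)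
      ≤ ∫⁻ p, ENNReal.ofReal (1 + t * (p.1 * p.2) + t ^ 2 * (w p.1 * w p.2)) ∂(α.prod α) :=
        lintegral_mono fun p ↦ ENNReal.ofReal_le_ofReal (hle p)
    _ = ENNReal.ofReal (∫ p, (1 + t * (p.1 * p.2) + t ^ 2 * (w p.1 * w p.2)) ∂(α.prod α)) :=
        (ofReal_integral_eq_lintegral_ofReal (hlin.add hquad)
          (ae_of_all _ fun p ↦ (Real.exp_pos _).le.trans (hle p))).symm
    _ = ENNReal.ofReal (1 + (t * ∫ x, w x ∂α) ^ 2) := by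
        rw [integral_add hlin hquad,
          integral_add (integrable_const _) ((hid.mul_prod hid).const_mul _), integral_const_mul,
          integral_const_mul, integral_prod_mul (fun x ↦ x) (fun x ↦ x), integral_prod_mul w w,
          hmean]
        simp only [integral_const, probReal_univ, smul_eq_mul, mul_one, mul_zero, add_zero]
        ring_nf

end SubGaussian

section SmallSignal

variable {v : ℝ≥0} {τ : Measure ℝ}

lemma smoothedDensity_dirac (x y : ℝ) :
    smoothedDensity v (Measure.dirac x) y = gaussianPDFReal 0 v (y - x) := by
  rw [smoothedDensity, integral_dirac]

lemma lintegral_exp_mul_gaussianReal (t : ℝ) :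
    ∫⁻ z, ENNReal.ofReal (Real.exp (t * z)) ∂(gaussianReal 0 v) =
      ENNReal.ofReal (Real.exp (v * t ^ 2 / 2)) := by
  rw [← ofReal_integral_eq_lintegral_ofReal (integrable_exp_mul_gaussianReal t)
    (ae_of_all _ fun z ↦ (Real.exp_pos _).le)]
  simpa [mgf] using congrArg ENNReal.ofReal (congrFun (mgf_fun_id_gaussianReal (μ := 0) (v := v)) t)

variable [NeZero v] [IsProbabilityMeasure τ]

lemma ofReal_exp_smoothedLogDensity_sub (y : ℝ) :
    ENNReal.ofReal (Real.exp (smoothedLogDensity v τ y - smoothedLogDensity v (Measure.dirac 0) y))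
      = ∫⁻ b, ENNReal.ofReal (Real.exp ((b * y - b ^ 2 / 2) / v)) ∂τ := by
  have hv : (v : ℝ) ≠ 0 := by exact_mod_cast NeZero.ne v
  have hpdf : 0 < gaussianPDFReal 0 v y := gaussianPDFReal_pos _ _ _ (NeZero.ne v)
  have hshift (b : ℝ) : gaussianPDF 0 v (y - b) =
      gaussianPDF 0 v y * ENNReal.ofReal (Real.exp ((b * y - b ^ 2 / 2) / v)) := by
    rw [gaussianPDF, gaussianPDF, ← ENNReal.ofReal_mul hpdf.le, gaussianPDFReal, gaussianPDFReal,
      mul_assoc _ (Real.exp _) (Real.exp _), ← Real.exp_add]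
    congr 3
    field_simp
    ring
  rw [smoothedLogDensity, smoothedLogDensity, Real.exp_sub, Real.exp_log (smoothedDensity_pos y),
    Real.exp_log (smoothedDensity_pos y), smoothedDensity_dirac, sub_zero,
    ENNReal.ofReal_div_of_pos hpdf, ofReal_smoothedDensity]
  simp_rw [hshift]
  rw [lintegral_const_mul _ (by fun_prop), mul_comm]
  exact ENNReal.mul_div_cancel_right (gaussianPDF_pos 0 (NeZero.ne v) y).ne' ENNReal.ofReal_ne_top

-- The left-hand side is `1` plus the `χ²`-divergence of `τ ∗ gaussianReal 0 v` from
-- `gaussianReal 0 v`.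
lemma lintegral_exp_smoothedLogDensity_sub :
    ∫⁻ y, ENNReal.ofReal
        (Real.exp (smoothedLogDensity v τ y - smoothedLogDensity v (Measure.dirac 0) y))
        ∂(τ ∗ gaussianReal 0 v) =
      ∫⁻ a, ∫⁻ b, ENNReal.ofReal (Real.exp (a * b / v)) ∂τ ∂τ := by
  have hv : (v : ℝ) ≠ 0 := by exact_mod_cast NeZero.ne v
  have hsplit (a b z : ℝ) : ENNReal.ofReal (Real.exp ((a * (b + z) - a ^ 2 / 2) / v)) =
      ENNReal.ofReal (Real.exp ((a * b - a ^ 2 / 2) / v)) *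
        ENNReal.ofReal (Real.exp (a / v * z)) := by
    rw [← ENNReal.ofReal_mul (Real.exp_pos _).le, ← Real.exp_add]
    ring_nf
  simp_rw [ofReal_exp_smoothedLogDensity_sub]
  rw [lintegral_lintegral_swap (by fun_prop)]
  refine lintegral_congr fun a ↦ ?_
  rw [Measure.lintegral_conv (by fun_prop)]
  refine lintegral_congr fun b ↦ ?_
  simp_rw [hsplit]
  rw [lintegral_const_mul _ (by fun_prop), lintegral_exp_mul_gaussianReal,
    ← ENNReal.ofReal_mul (Real.exp_pos _).le, ← Real.exp_add]
  congr 2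
  field_simp
  ring

lemma toReal_klDiv_conv_gaussianReal_le {ρ α : Measure ℝ} [IsProbabilityMeasure ρ]
    [IsProbabilityMeasure α] {c : ℝ} (hc : 0 < c)
    (h : Integrable (fun x ↦ Real.exp (c * x ^ 2)) α) (hmean : ∫ x, x ∂α = 0) {ε : ℝ}
    (hε : ε ^ 2 ≤ c * v) :
    (klDiv ((ρ ∗ α.map (ε * ·)) ∗ gaussianReal 0 v) (ρ ∗ gaussianReal 0 v)).toReal ≤
      (ε ^ 2 / v * ∫ x, x ^ 2 * Real.exp (c / 2 * x ^ 2) ∂α) ^ 2 := by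
  have hv : (0 : ℝ) < v := by exact_mod_cast NeZero.pos v
  have : IsProbabilityMeasure (α.map (ε * ·)) := Measure.isProbabilityMeasure_map (by fun_prop)
  have hα : MemLp id 2 (α.map (ε * ·)) :=
    memLp_id_map_const_mul (memLp_id_of_integrable_exp_mul_sq hc h 2) ε
  have hδ : MemLp id 2 (Measure.dirac (0 : ℝ)) := memLp_id_dirac 0 2
  have h2 := memLp_two_conv_gaussianReal hα 0 v
  have hdata : klDiv ((ρ ∗ α.map (ε * ·)) ∗ gaussianReal 0 v) (ρ ∗ gaussianReal 0 v) ≤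
      klDiv (α.map (ε * ·) ∗ gaussianReal 0 v) (Measure.dirac 0 ∗ gaussianReal 0 v) := by
    rw [Measure.dirac_zero_conv, Measure.conv_assoc, Measure.conv_comm ρ, Measure.conv_comm ρ]
    exact klDiv_conv_le _ _ ρ
  refine (ENNReal.toReal_mono (klDiv_conv_gaussianReal_ne_top hα hδ) hdata).trans ?_
  rw [toReal_klDiv_conv_gaussianReal]
  have hscale (a : ℝ) : ∫⁻ b, ENNReal.ofReal (Real.exp (ε * a * b / v)) ∂α.map (ε * ·) =
      ∫⁻ b, ENNReal.ofReal (Real.exp (ε ^ 2 / v * (a * b))) ∂α := by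
    rw [lintegral_map (by fun_prop) (by fun_prop)]
    exact lintegral_congr fun b ↦ by ring_nf
  refine integral_le_of_lintegral_exp_le (f := fun y ↦ smoothedLogDensity v _ y - _)
    ((integrable_smoothedLogDensity hα h2).sub (integrable_smoothedLogDensity hδ h2))
    (sq_nonneg _) ?_
  rw [lintegral_exp_smoothedLogDensity_sub, lintegral_map (by fun_prop) (by fun_prop)]
  simp_rw [hscale]
  refine lintegral_lintegral_exp_mul_le hc h hmean ?_
  rwa [abs_of_nonneg (by positivity), div_le_iff₀ hv]

end SmallSignal

section Objective

lemma memLp_two_iff_secondMoment_ne_top {μ : Measure ℝ} :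
    MemLp id 2 μ ↔ secondMoment μ ≠ ∞ := by
  rw [memLp_two_iff_integrable_sq (by fun_prop), ← lt_top_iff_ne_top, secondMoment,
    ← hasFiniteIntegral_iff_ofReal (ae_of_all _ fun x ↦ sq_nonneg x)]
  exact and_iff_right (by fun_prop)

lemma secondMoment_eq_ofReal {μ : Measure ℝ} (hμ : MemLp id 2 μ) :
    secondMoment μ = ENNReal.ofReal (∫ x, x ^ 2 ∂μ) :=
  (ofReal_integral_eq_lintegral_ofReal hμ.integrable_sq (ae_of_all _ fun x ↦ sq_nonneg x)).symm

/-- The value `u h(X + A + Z) + h(X + Z) - (1 + u) h(X + B + Z)` for independent `X`, `A`, `B` with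
laws `ρ`, `α`, `β` and Gaussian noise `Z` of variance `v`. The objective `zObjective` is of this
form with `A = X₂ + Z₂` and `B = Z₂`, up to the power term. -/
noncomputable def entropyGap (u v : ℝ≥0) (ρ α β : Measure ℝ) : ℝ :=
  u * smoothedEntropy v (ρ ∗ α) + smoothedEntropy v ρ - (1 + u) * smoothedEntropy v (ρ ∗ β)

variable {u v N S : ℝ≥0} [NeZero v] {μ κ ξ : Measure ℝ} [IsProbabilityMeasure μ]

lemma zObjective_eq_coe_entropyGap_sub [IsProbabilityMeasure κ] (hμ : MemLp id 2 μ)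
    (hκ : MemLp id 2 κ) :
    zObjective u v N S (μ, κ) =
      (entropyGap u v μ (κ ∗ gaussianReal 0 N) (gaussianReal 0 N) - S * ∫ x, x ^ 2 ∂μ : ℝ) := by
  have hN : MemLp id 2 (gaussianReal 0 N) := memLp_id_gaussianReal 2
  have hα : μ ∗ (κ ∗ (gaussianReal 0 v ∗ gaussianReal 0 N)) =
      (μ ∗ (κ ∗ gaussianReal 0 N)) ∗ gaussianReal 0 v := by
    rw [Measure.conv_comm (gaussianReal 0 v), ← Measure.conv_assoc κ, ← Measure.conv_assoc μ]
  have hβ : μ ∗ (gaussianReal 0 v ∗ gaussianReal 0 N) =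
      (μ ∗ gaussianReal 0 N) ∗ gaussianReal 0 v := by
    rw [Measure.conv_comm (gaussianReal 0 v), ← Measure.conv_assoc μ]
  rw [zObjective, hα, hβ,
    differentialEntropy_conv_gaussianReal (memLp_id_conv hμ (memLp_id_conv hκ hN)),
    differentialEntropy_conv_gaussianReal hμ,
    differentialEntropy_conv_gaussianReal (memLp_id_conv hμ hN),
    secondMoment_eq_ofReal hμ, EReal.coe_ennreal_ofReal,
    max_eq_left (integral_nonneg fun x ↦ sq_nonneg x)]
  norm_cast

lemma exists_pos_and_zObjective_pos [IsProbabilityMeasure κ] (hμ : MemLp id 2 μ)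
    (hκ : MemLp id 2 κ) (hgap : 0 < entropyGap u v μ (κ ∗ gaussianReal 0 N) (gaussianReal 0 N)) :
    ∃ S : ℝ≥0, 0 < S ∧ 0 < zObjective u v N S (μ, κ) := by
  set F := entropyGap u v μ (κ ∗ gaussianReal 0 N) (gaussianReal 0 N)
  have : 0 ≤ ∫ x, x ^ 2 ∂μ := integral_nonneg fun x ↦ sq_nonneg x
  have hS : 0 < F / (1 + ∫ x, x ^ 2 ∂μ) := by positivity
  refine ⟨_, Real.toNNReal_pos.2 hS, ?_⟩
  rw [zObjective_eq_coe_entropyGap_sub hμ hκ, Real.coe_toNNReal _ hS.le]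
  have hpower : F / (1 + ∫ x, x ^ 2 ∂μ) * ∫ x, x ^ 2 ∂μ < F := by
    rw [div_mul_eq_mul_div, div_lt_iff₀ (by positivity)]
    gcongr
    linarith
  exact_mod_cast sub_pos.2 hpower

lemma entropyGap_conv_conv_nonpos [IsProbabilityMeasure κ] [IsProbabilityMeasure ξ] (hu : u ≤ 1)
    (hμ : MemLp id 2 μ) (hκ : MemLp id 2 κ) (hξ : MemLp id 2 ξ) :
    entropyGap u v μ (κ ∗ (κ ∗ ξ)) (κ ∗ ξ) ≤ 0 := by
  have hκξ := memLp_id_conv hκ hξ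
  have hsub := smoothedEntropy_conv_conv_add_le (v := v) hμ hκ hκξ
  have hξ_mono := smoothedEntropy_le_smoothedEntropy_conv (v := v) (memLp_id_conv hμ hκ) hξ
  have hκξ_mono := smoothedEntropy_le_smoothedEntropy_conv (v := v) hμ hκξ
  rw [Measure.conv_assoc] at hsub hξ_mono
  have : (u : ℝ) ≤ 1 := by exact_mod_cast hu
  rw [entropyGap]
  nlinarith [u.coe_nonneg]

lemma zObjective_nonpos_of_isGaussian [IsGaussian κ] (hu : u ≤ 1) (hS : 0 < S)
    (hκ : secondMoment κ ≤ N) : zObjective u v N S (μ, κ) ≤ 0 := by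
  by_cases hμ : secondMoment μ = ∞
  · rw [zObjective, hμ, EReal.coe_ennreal_top, EReal.coe_mul_top_of_pos (by exact_mod_cast hS),
      EReal.sub_top]
    exact bot_le
  rw [← ne_eq, ← memLp_two_iff_secondMoment_ne_top] at hμ
  obtain ⟨m, w, rfl⟩ : ∃ m w, κ = gaussianReal m w :=
    ⟨_, _, IsGaussian.eq_gaussianReal κ inferInstance⟩
  have hκ2 : MemLp id 2 (gaussianReal m w) := memLp_id_gaussianReal 2
  have hw : w ≤ N := by
    rw [secondMoment_eq_ofReal hκ2, ← ENNReal.ofReal_coe_nnreal,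
      ENNReal.ofReal_le_ofReal_iff N.coe_nonneg] at hκ
    have hvar := variance_le_expectation_sq (μ := gaussianReal m w) (X := id) (by fun_prop)
    rw [variance_id_gaussianReal] at hvar
    exact_mod_cast hvar.trans hκ
  have hN : gaussianReal m w ∗ gaussianReal (-m) (N - w) = gaussianReal 0 N := by
    rw [gaussianReal_conv_gaussianReal, add_neg_cancel, add_tsub_cancel_of_le hw]
  have hgap := entropyGap_conv_conv_nonpos (v := v) hu hμ hκ2
    (memLp_id_gaussianReal (μ := -m) (v := N - w) 2)
  rw [hN] at hgap
  rw [zObjective_eq_coe_entropyGap_sub hμ hκ2]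
  exact_mod_cast sub_nonpos.2 (hgap.trans (by positivity))

end Objective

section TaylorExpansion

variable {f : ℝ → ℝ} {n : ℕ} {M : ℝ}

lemma abs_sub_sum_iteratedDeriv_le (hf : ContDiff ℝ (n + 1) f)
    (hM : ∀ t, |iteratedDeriv (n + 1) f t| ≤ M) (x y : ℝ) :
    |f (x + y) - ∑ k ∈ Finset.range (n + 1), x ^ k / k.factorial * iteratedDeriv k f y| ≤
      M / (n + 1).factorial * |x| ^ (n + 1) := by
  rcases eq_or_ne x 0 with rfl | hx
  · simp [Finset.sum_range_succ']
  have hne : y ≠ x + y := by simpa using hx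
  obtain ⟨z, -, hz⟩ := taylor_mean_remainder_lagrange_iteratedDeriv hne hf.contDiffOn
  have htaylor : taylorWithinEval f n (Set.uIcc y (x + y)) y (x + y) =
      ∑ k ∈ Finset.range (n + 1), x ^ k / k.factorial * iteratedDeriv k f y := by
    rw [taylor_within_apply]
    refine Finset.sum_congr rfl fun k hk ↦ ?_
    have hk : (k : WithTop ℕ∞) ≤ n + 1 := by
      exact_mod_cast (Finset.mem_range.1 hk).le
    rw [iteratedDerivWithin_eq_iteratedDeriv (uniqueDiffOn_uIcc hne)
      (hf.of_le hk).contDiffAt Set.left_mem_uIcc, add_sub_cancel_right, smul_eq_mul,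
      div_eq_inv_mul]
  rw [← htaylor, hz, add_sub_cancel_right, abs_div, abs_mul, abs_pow, Nat.abs_cast,
    div_mul_eq_mul_div]
  gcongr
  exact hM z

lemma integrable_pow_of_memLp_id {τ : Measure ℝ} [IsFiniteMeasure τ] (hτ : MemLp id n τ) {k : ℕ}
    (hk : k ≤ n) : Integrable (fun x ↦ x ^ k) τ := by
  rw [← integrable_norm_iff (by fun_prop)]
  simpa using (hτ.mono_exponent (by exact_mod_cast hk)).integrable_norm_pow' (p := k)

lemma abs_integral_conv_sub_sum_le {P τ : Measure ℝ} [IsProbabilityMeasure P]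
    [IsProbabilityMeasure τ] (hf : ContDiff ℝ (n + 1) f)
    (hM : ∀ t, |iteratedDeriv (n + 1) f t| ≤ M) (hτ : MemLp id (n + 1 : ℕ) τ)
    (hfint : Integrable f (τ ∗ P)) (hP : ∀ k ≤ n, Integrable (iteratedDeriv k f) P) :
    |∫ y, f y ∂(τ ∗ P) - ∑ k ∈ Finset.range (n + 1),
        (∫ x, x ^ k ∂τ) / k.factorial * ∫ y, iteratedDeriv k f y ∂P| ≤
      M / (n + 1).factorial * ∫ x, |x| ^ (n + 1) ∂τ := by
  have hadd : Integrable (fun p : ℝ × ℝ ↦ f (p.1 + p.2)) (τ.prod P) :=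
    (integrable_map_measure hfint.1 (by fun_prop)).1 hfint
  have hterm (k : ℕ) (hk : k ∈ Finset.range (n + 1)) :
      Integrable (fun p : ℝ × ℝ ↦ p.1 ^ k / k.factorial * iteratedDeriv k f p.2) (τ.prod P) := by
    have hk := Finset.mem_range.1 hk
    exact ((integrable_pow_of_memLp_id hτ hk.le).div_const _).mul_prod
      (hP k (Nat.lt_succ_iff.1 hk))
  have hrem : Integrable (fun x ↦ |x| ^ (n + 1)) τ := by
    simpa only [abs_pow] using (integrable_pow_of_memLp_id hτ le_rfl).abs
  have hdiff : ∫ y, f y ∂(τ ∗ P) - ∑ k ∈ Finset.range (n + 1),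
        (∫ x, x ^ k ∂τ) / k.factorial * ∫ y, iteratedDeriv k f y ∂P =
      ∫ p, (f (p.1 + p.2) - ∑ k ∈ Finset.range (n + 1),
        p.1 ^ k / k.factorial * iteratedDeriv k f p.2) ∂(τ.prod P) := by
    rw [integral_sub hadd (integrable_finsetSum _ hterm), integral_finsetSum _ hterm,
      Measure.conv, integral_map (by fun_prop) hfint.1]
    congr 1
    refine Finset.sum_congr rfl fun k _ ↦ ?_
    rw [integral_prod_mul (fun x : ℝ ↦ x ^ k / k.factorial), integral_div]
  rw [hdiff, ← Real.norm_eq_abs]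
  refine (norm_integral_le_of_norm_le ((hrem.const_mul _).comp_fst P)
    (ae_of_all _ fun p ↦ abs_sub_sum_iteratedDeriv_le hf hM p.1 p.2)).trans_eq ?_
  rw [integral_fun_fst (fun x : ℝ ↦ M / (n + 1).factorial * |x| ^ (n + 1)), integral_const_mul]
  simp

lemma abs_integral_conv_map_mul_sub_le {P τ : Measure ℝ} [IsProbabilityMeasure P]
    [IsProbabilityMeasure τ] (hf : ContDiff ℝ 4 f) (hM : ∀ t, |iteratedDeriv 4 f t| ≤ M)
    (hτ : MemLp id 4 τ) (hmean : ∫ x, x ∂τ = 0) {ε : ℝ}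
    (hfint : Integrable f (τ.map (ε * ·) ∗ P)) (hP : ∀ k ≤ 3, Integrable (iteratedDeriv k f) P) :
    |∫ y, f y ∂(τ.map (ε * ·) ∗ P) - (∫ y, f y ∂P +
        ε ^ 2 / 2 * (∫ x, x ^ 2 ∂τ) * ∫ y, iteratedDeriv 2 f y ∂P +
        ε ^ 3 / 6 * (∫ x, x ^ 3 ∂τ) * ∫ y, iteratedDeriv 3 f y ∂P)| ≤
      M / 24 * (∫ x, x ^ 4 ∂τ) * ε ^ 4 := by
  have : IsProbabilityMeasure (τ.map (ε * ·)) := Measure.isProbabilityMeasure_map (by fun_prop)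
  have hmem : MemLp id (3 + 1 : ℕ) (τ.map (ε * ·)) := by
    simpa using memLp_id_map_const_mul hτ ε
  have hpow (k : ℕ) : ∫ x, x ^ k ∂τ.map (ε * ·) = ε ^ k * ∫ x, x ^ k ∂τ := by
    rw [integral_map (by fun_prop) (by fun_prop), ← integral_const_mul]
    simp_rw [mul_pow]
  have hrem : ∫ x, |x| ^ (3 + 1) ∂τ.map (ε * ·) = ε ^ 4 * ∫ x, x ^ 4 ∂τ := by
    rw [← hpow]
    simp_rw [Even.pow_abs (show Even (3 + 1) by decide)]
  have htaylor := abs_integral_conv_sub_sum_le (n := 3) (by norm_num; exact hf) hM hmem hfint hP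
  rw [hrem] at htaylor
  convert htaylor using 1
  · simp only [Finset.sum_range_succ, Finset.sum_range_zero, hpow, pow_one, hmean,
      iteratedDeriv_zero, pow_zero, integral_const, probReal_univ, Nat.factorial]
    congr 1
    norm_num
    ring
  · norm_num [Nat.factorial]
    ring

end TaylorExpansion

section Perturbation

variable {u v : ℝ≥0} [NeZero v] {ρ α β : Measure ℝ} [IsProbabilityMeasure ρ]
  [IsProbabilityMeasure α] [IsProbabilityMeasure β]

-- Gibbs' inequality: replacing the entropies of `ρ ∗ α` and `ρ ∗ β` by cross entropies relative to
-- `ρ` costs the divergence of `ρ ∗ α` and only helps for `ρ ∗ β`.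
lemma le_entropyGap (hρ : MemLp id 2 ρ) (hα : MemLp id 2 α) (hβ : MemLp id 2 β) :
    (1 + u) * ∫ y, smoothedLogDensity v ρ y ∂((ρ ∗ β) ∗ gaussianReal 0 v) -
        u * ∫ y, smoothedLogDensity v ρ y ∂((ρ ∗ α) ∗ gaussianReal 0 v) -
        ∫ y, smoothedLogDensity v ρ y ∂(ρ ∗ gaussianReal 0 v) -
        u * (klDiv ((ρ ∗ α) ∗ gaussianReal 0 v) (ρ ∗ gaussianReal 0 v)).toReal ≤
      entropyGap u v ρ α β := by
  have hhα := toReal_klDiv_conv_gaussianReal_eq_sub (v := v) (memLp_id_conv hρ hα) hρ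
  have hhβ := smoothedEntropy_le_neg_integral_smoothedLogDensity (v := v) (memLp_id_conv hρ hβ) hρ
  have hu : (0 : ℝ) ≤ 1 + u := by positivity
  rw [entropyGap, hhα, smoothedEntropy.eq_1 v ρ]
  linarith [mul_le_mul_of_nonneg_left hhβ hu]

variable {c M : ℝ}

lemma abs_integral_smoothedLogDensity_conv_map_mul_sub_le {τ : Measure ℝ} [IsProbabilityMeasure τ]
    (hρ : MemLp id 2 ρ) (hL : ContDiff ℝ 4 (smoothedLogDensity v ρ))
    (hM : ∀ t, |iteratedDeriv 4 (smoothedLogDensity v ρ) t| ≤ M)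
    (hint : ∀ k ≤ 3, Integrable (iteratedDeriv k (smoothedLogDensity v ρ)) (ρ ∗ gaussianReal 0 v))
    (hτ : MemLp id 4 τ) (hmean : ∫ x, x ∂τ = 0) (ε : ℝ) :
    |∫ y, smoothedLogDensity v ρ y ∂((ρ ∗ τ.map (ε * ·)) ∗ gaussianReal 0 v) -
        (∫ y, smoothedLogDensity v ρ y ∂(ρ ∗ gaussianReal 0 v) +
          ε ^ 2 / 2 * (∫ x, x ^ 2 ∂τ) *
            ∫ y, iteratedDeriv 2 (smoothedLogDensity v ρ) y ∂(ρ ∗ gaussianReal 0 v) +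
          ε ^ 3 / 6 * (∫ x, x ^ 3 ∂τ) *
            ∫ y, iteratedDeriv 3 (smoothedLogDensity v ρ) y ∂(ρ ∗ gaussianReal 0 v))| ≤
      M / 24 * (∫ x, x ^ 4 ∂τ) * ε ^ 4 := by
  have : IsProbabilityMeasure (τ.map (ε * ·)) := Measure.isProbabilityMeasure_map (by fun_prop)
  rw [Measure.conv_comm ρ, Measure.conv_assoc]
  exact abs_integral_conv_map_mul_sub_le hL hM hτ hmean (integrable_smoothedLogDensity hρ
    (memLp_id_conv (memLp_id_map_const_mul (hτ.mono_exponent (by norm_num)) ε)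
      (memLp_two_conv_gaussianReal hρ 0 v))) hint

lemma exists_le_entropyGap_map_mul (hρ : MemLp id 2 ρ)
    (hL : ContDiff ℝ 4 (smoothedLogDensity v ρ))
    (hM : ∀ t, |iteratedDeriv 4 (smoothedLogDensity v ρ) t| ≤ M)
    (hint : ∀ k ≤ 3, Integrable (iteratedDeriv k (smoothedLogDensity v ρ)) (ρ ∗ gaussianReal 0 v))
    (hc : 0 < c) (hα : Integrable (fun x ↦ Real.exp (c * x ^ 2)) α) (hα_mean : ∫ x, x ∂α = 0)
    (hβ : MemLp id 4 β) (hβ_mean : ∫ x, x ∂β = 0)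
    (hsq : u * ∫ x, x ^ 2 ∂α = (1 + u) * ∫ x, x ^ 2 ∂β) (hβ_cube : ∫ x, x ^ 3 ∂β = 0) :
    ∃ C, ∀ ε : ℝ, ε ^ 2 ≤ c * v →
      -(u / 6 * (∫ x, x ^ 3 ∂α) *
        ∫ y, iteratedDeriv 3 (smoothedLogDensity v ρ) y ∂(ρ ∗ gaussianReal 0 v)) * ε ^ 3 -
          C * ε ^ 4 ≤
        entropyGap u v ρ (α.map (ε * ·)) (β.map (ε * ·)) := by
  have hα4 : MemLp id 4 α := memLp_id_of_integrable_exp_mul_sq hc hα 4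
  refine ⟨u * (M / 24 * ∫ x, x ^ 4 ∂α) + (1 + u) * (M / 24 * ∫ x, x ^ 4 ∂β) +
    u * ((∫ x, x ^ 2 * Real.exp (c / 2 * x ^ 2) ∂α) / v) ^ 2, fun ε hε ↦ ?_⟩
  have : IsProbabilityMeasure (α.map (ε * ·)) := Measure.isProbabilityMeasure_map (by fun_prop)
  have : IsProbabilityMeasure (β.map (ε * ·)) := Measure.isProbabilityMeasure_map (by fun_prop)
  refine le_trans ?_ (le_entropyGap hρ
    (memLp_id_map_const_mul (hα4.mono_exponent (by norm_num)) ε)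
    (memLp_id_map_const_mul (hβ.mono_exponent (by norm_num)) ε))
  have hIα := (abs_le.1
    (abs_integral_smoothedLogDensity_conv_map_mul_sub_le hρ hL hM hint hα4 hα_mean ε)).2
  have hIβ := (abs_le.1
    (abs_integral_smoothedLogDensity_conv_map_mul_sub_le hρ hL hM hint hβ hβ_mean ε)).1
  have hkl := toReal_klDiv_conv_gaussianReal_le (ρ := ρ) hc hα hα_mean hε
  rw [hβ_cube] at hIβ
  have hu : (0 : ℝ) ≤ u := u.coe_nonneg
  linear_combination mul_le_mul_of_nonneg_left hIα hu +
    mul_le_mul_of_nonneg_left hIβ (add_nonneg zero_le_one hu) +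
    mul_le_mul_of_nonneg_left hkl hu +
    ε ^ 2 / 2 * (∫ y, iteratedDeriv 2 (smoothedLogDensity v ρ) y ∂(ρ ∗ gaussianReal 0 v)) * hsq

lemma exists_pos_and_entropyGap_map_mul_pos (hu : 0 < u) (hρ : MemLp id 2 ρ)
    (hL : ContDiff ℝ 4 (smoothedLogDensity v ρ))
    (hM : ∀ t, |iteratedDeriv 4 (smoothedLogDensity v ρ) t| ≤ M)
    (hint : ∀ k ≤ 3, Integrable (iteratedDeriv k (smoothedLogDensity v ρ)) (ρ ∗ gaussianReal 0 v))
    (hL_pos : 0 < ∫ y, iteratedDeriv 3 (smoothedLogDensity v ρ) y ∂(ρ ∗ gaussianReal 0 v))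
    (hc : 0 < c) (hα : Integrable (fun x ↦ Real.exp (c * x ^ 2)) α) (hα_mean : ∫ x, x ∂α = 0)
    (hα_cube : ∫ x, x ^ 3 ∂α < 0) (hβ : MemLp id 4 β) (hβ_mean : ∫ x, x ∂β = 0)
    (hsq : u * ∫ x, x ^ 2 ∂α = (1 + u) * ∫ x, x ^ 2 ∂β) (hβ_cube : ∫ x, x ^ 3 ∂β = 0) :
    ∃ ε : ℝ≥0, 0 < ε ∧ 0 < entropyGap u v ρ (α.map (ε * ·)) (β.map (ε * ·)) := by
  obtain ⟨C, hC⟩ :=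
    exists_le_entropyGap_map_mul hρ hL hM hint hc hα hα_mean hβ hβ_mean hsq hβ_cube
  set a := -(u / 6 * (∫ x, x ^ 3 ∂α) *
    ∫ y, iteratedDeriv 3 (smoothedLogDensity v ρ) y ∂(ρ ∗ gaussianReal 0 v))
  have ha : 0 < a := neg_pos.2 (mul_neg_of_neg_of_pos
    (mul_neg_of_pos_of_neg (by positivity) hα_cube) hL_pos)
  have hcv : 0 < c * v := mul_pos hc (by exact_mod_cast NeZero.pos v)
  have hlead : ∀ᶠ ε : ℝ in nhdsWithin 0 (Set.Ioi 0), 0 < a - C * ε :=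
    nhdsWithin_le_nhds ((by fun_prop : ContinuousAt (fun ε ↦ a - C * ε) 0).eventually_const_lt
      (by simpa using ha))
  have hsmall : ∀ᶠ ε : ℝ in nhdsWithin 0 (Set.Ioi 0), ε ^ 2 < c * v :=
    nhdsWithin_le_nhds ((by fun_prop : ContinuousAt (fun ε : ℝ ↦ ε ^ 2) 0).eventually_lt_const
      (by simpa using hcv))
  obtain ⟨ε, hlead, hsmall, hε⟩ := (hlead.and (hsmall.and self_mem_nhdsWithin)).exists
  lift ε to ℝ≥0 using le_of_lt hε
  refine ⟨ε, by exact_mod_cast hε, lt_of_lt_of_le ?_ (hC ε hsmall.le)⟩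
  have : (0 : ℝ) < ε := hε
  calc 0 < (a - C * ε) * ε ^ 3 := by positivity
    _ = a * ε ^ 3 - C * ε ^ 4 := by ring

end Perturbation

section Moments

variable {μ ν : Measure ℝ}

lemma integrable_exp_mul_sq_conv {c : ℝ} (hc : 0 ≤ c)
    (hμ : Integrable (fun x ↦ Real.exp (2 * c * x ^ 2)) μ)
    (hν : Integrable (fun x ↦ Real.exp (2 * c * x ^ 2)) ν) :
    Integrable (fun x ↦ Real.exp (c * x ^ 2)) (μ ∗ ν) := by
  rw [Measure.conv, integrable_map_measure (by fun_prop) (by fun_prop)]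
  refine (hμ.mul_prod hν).mono' (by fun_prop) (ae_of_all _ fun p ↦ ?_)
  rw [Function.comp_apply, Real.norm_of_nonneg (Real.exp_pos _).le, ← Real.exp_add,
    Real.exp_le_exp]
  nlinarith [mul_nonneg hc (sq_nonneg (p.1 - p.2))]

lemma integral_pow_conv [IsProbabilityMeasure μ] [IsProbabilityMeasure ν] {n : ℕ}
    (hμ : MemLp id n μ) (hν : MemLp id n ν) :
    ∫ x, x ^ n ∂(μ ∗ ν) =
      ∑ k ∈ Finset.range (n + 1), (∫ x, x ^ k ∂μ) * (∫ x, x ^ (n - k) ∂ν) * n.choose k := by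
  have hterm (k : ℕ) (hk : k ∈ Finset.range (n + 1)) :
      Integrable (fun p : ℝ × ℝ ↦ p.1 ^ k * p.2 ^ (n - k) * n.choose k) (μ.prod ν) :=
    ((integrable_pow_of_memLp_id hμ (Nat.lt_succ_iff.1 (Finset.mem_range.1 hk))).mul_prod
      (integrable_pow_of_memLp_id hν (n.sub_le k))).mul_const _
  rw [Measure.conv, integral_map (by fun_prop) (by fun_prop)]
  simp_rw [add_pow]
  rw [integral_finsetSum _ hterm]
  refine Finset.sum_congr rfl fun k _ ↦ ?_
  rw [integral_mul_const, integral_prod_mul (fun x ↦ x ^ k) (fun x ↦ x ^ (n - k))]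

lemma gaussianReal_zero_one_map_mul (ε : ℝ≥0) :
    (gaussianReal 0 1).map ((ε : ℝ) * ·) = gaussianReal 0 (ε ^ 2) := by
  rw [gaussianReal_map_const_mul, mul_zero, mul_one]
  congr

lemma integral_pow_gaussianReal_zero_of_odd (v : ℝ≥0) {n : ℕ} (hn : Odd n) :
    ∫ x, x ^ n ∂gaussianReal 0 v = 0 := by
  have hneg : ∫ x, x ^ n ∂gaussianReal 0 v = -∫ x, x ^ n ∂gaussianReal 0 v := by
    conv_lhs => rw [← neg_zero, ← gaussianReal_map_neg, integral_map (by fun_prop) (by fun_prop)]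
    simp_rw [hn.neg_pow, integral_neg]
  linarith

lemma integral_sq_gaussianReal_zero (v : ℝ≥0) : ∫ x, x ^ 2 ∂gaussianReal 0 v = v := by
  rw [← variance_of_integral_eq_zero (X := fun x ↦ x) (by fun_prop) (by simp)]
  exact variance_id_gaussianReal

lemma exists_integrable_exp_mul_sq_gaussianReal (m : ℝ) (v : ℝ≥0) :
    ∃ c, 0 < c ∧ Integrable (fun x ↦ Real.exp (c * x ^ 2)) (gaussianReal m v) := by
  simpa using IsGaussian.exists_integrable_exp_sq (gaussianReal m v)

end Moments

section SpikeInput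

/-- The law of an input that takes the value `1` with log-odds `-c` and vanishes otherwise. For
large `c` the input is a rare spike, and the posterior below makes the third derivative of the
smoothed log-density positive on average. -/
noncomputable abbrev spikeInput (c : ℝ) : Measure ℝ :=
  bernoulliMeasure 1 0 (unitInterval.sigmoid (-c))

/-- The conditional probability that the input `spikeInput c` is `1` given that, after adding
standard Gaussian noise, `y` is observed. -/
noncomputable def spikePosterior (c y : ℝ) : ℝ := Real.sigmoid (y - (c + 1 / 2))

lemma spikePosterior_pos (c y : ℝ) : 0 < spikePosterior c y := Real.sigmoid_pos _

lemma spikePosterior_lt_one (c y : ℝ) : spikePosterior c y < 1 := Real.sigmoid_lt_one _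

lemma spikePosterior_le_exp (c y : ℝ) : spikePosterior c y ≤ Real.exp (y - (c + 1 / 2)) := by
  rw [spikePosterior, ← neg_neg (y - _), ← Real.sigmoid_mul_rexp_neg]
  exact mul_le_of_le_one_left (Real.exp_pos _).le (Real.sigmoid_le_one _)

variable {c : ℝ}

@[fun_prop]
lemma continuous_spikePosterior : Continuous (spikePosterior c) :=
  continuous_sigmoid.comp (by fun_prop)

lemma hasDerivAt_spikePosterior (y : ℝ) :
    HasDerivAt (spikePosterior c) (spikePosterior c y * (1 - spikePosterior c y)) y :=
  (Real.hasDerivAt_sigmoid _).comp_sub_const y (c + 1 / 2)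

lemma memLp_id_spikeInput (p : ℝ≥0) : MemLp id p (spikeInput c) :=
  memLp_id_of_integrable_exp_mul_sq one_pos (integrable_bernoulliMeasure _ _ _ _) p

-- Bayes' rule: both sides are the joint density of the input being `1` and the output being `y`.
lemma smoothedDensity_spikeInput_mul_spikePosterior (y : ℝ) :
    smoothedDensity 1 (spikeInput c) y * spikePosterior c y =
      Real.sigmoid (-c) * gaussianPDFReal 1 1 y := by
  have hweight : 1 - Real.sigmoid (-c) = Real.sigmoid (-c) * Real.exp c := by
    simpa [Real.sigmoid_neg] using (Real.sigmoid_mul_rexp_neg (-c)).symm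
  have htilt : gaussianPDFReal 0 1 y = gaussianPDFReal 1 1 y * Real.exp (1 / 2 - y) := by
    rw [gaussianPDFReal, gaussianPDFReal, mul_assoc _ (Real.exp _) (Real.exp _), ← Real.exp_add]
    congr 2
    push_cast
    ring
  have hodds : Real.exp c * Real.exp (1 / 2 - y) = Real.exp (-(y - (c + 1 / 2))) := by
    rw [← Real.exp_add]
    ring_nf
  have hcoe : (unitInterval.sigmoid (-c) : ℝ) = Real.sigmoid (-c) := rfl
  have hne : 1 + Real.exp (-(y - (c + 1 / 2))) ≠ 0 := by positivity
  rw [smoothedDensity, integral_bernoulliMeasure, gaussianPDFReal_sub, zero_add, sub_zero,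
    smul_eq_mul, smul_eq_mul, hcoe, hweight, htilt, spikePosterior, Real.sigmoid_def (y - _),
    mul_inv_eq_iff_eq_mul₀ hne, ← hodds]
  ring

lemma smoothedLogDensity_spikeInput (y : ℝ) :
    smoothedLogDensity 1 (spikeInput c) y =
      Real.log (Real.sigmoid (-c)) - Real.log √(2 * Real.pi) - (y - 1) ^ 2 / 2 -
        Real.log (spikePosterior c y) := by
  have hlog := congrArg Real.log (smoothedDensity_spikeInput_mul_spikePosterior (c := c) y)
  rw [Real.log_mul (smoothedDensity_pos y).ne' (spikePosterior_pos c y).ne',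
    Real.log_mul (Real.sigmoid_pos _).ne' (gaussianPDFReal_pos _ _ _ one_ne_zero).ne',
    log_gaussianPDFReal] at hlog
  simp only [NNReal.coe_one, mul_one] at hlog
  rw [smoothedLogDensity]
  linarith

lemma contDiff_smoothedLogDensity_spikeInput (n : ℕ) :
    ContDiff ℝ n (smoothedLogDensity 1 (spikeInput c)) := by
  have hpost : ContDiff ℝ n (spikePosterior c) :=
    (contDiff_sigmoid.of_le le_top).comp (contDiff_id.sub contDiff_const)
  rw [funext smoothedLogDensity_spikeInput]
  exact (contDiff_const.sub (by fun_prop)).sub (hpost.log fun y ↦ (spikePosterior_pos c y).ne')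

lemma iteratedDeriv_one_smoothedLogDensity_spikeInput :
    iteratedDeriv 1 (smoothedLogDensity 1 (spikeInput c)) = fun y ↦ spikePosterior c y - y := by
  rw [iteratedDeriv_one, funext smoothedLogDensity_spikeInput]
  funext y
  have hquad : HasDerivAt (fun y : ℝ ↦ (y - 1) ^ 2 / 2) (y - 1) y := by
    simpa using (((hasDerivAt_id y).sub_const 1).pow 2).div_const 2
  have hlog := (hasDerivAt_spikePosterior (c := c) y).log (spikePosterior_pos c y).ne'
  rw [mul_div_cancel_left₀ _ (spikePosterior_pos c y).ne'] at hlog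
  rw [((hquad.const_sub _).fun_sub hlog).deriv]
  ring

lemma iteratedDeriv_two_smoothedLogDensity_spikeInput :
    iteratedDeriv 2 (smoothedLogDensity 1 (spikeInput c)) =
      fun y ↦ spikePosterior c y * (1 - spikePosterior c y) - 1 := by
  rw [iteratedDeriv_succ, iteratedDeriv_one_smoothedLogDensity_spikeInput]
  funext y
  exact ((hasDerivAt_spikePosterior y).sub (hasDerivAt_id y)).deriv

lemma iteratedDeriv_three_smoothedLogDensity_spikeInput :
    iteratedDeriv 3 (smoothedLogDensity 1 (spikeInput c)) =
      fun y ↦ spikePosterior c y * ((1 - spikePosterior c y) * (1 - 2 * spikePosterior c y)) := by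
  rw [iteratedDeriv_succ, iteratedDeriv_two_smoothedLogDensity_spikeInput]
  funext y
  have h := hasDerivAt_spikePosterior (c := c) y
  rw [((h.fun_mul (h.const_sub 1)).sub_const 1).deriv]
  ring

lemma iteratedDeriv_four_smoothedLogDensity_spikeInput :
    iteratedDeriv 4 (smoothedLogDensity 1 (spikeInput c)) =
      fun y ↦ spikePosterior c y * (1 - spikePosterior c y) *
        (1 - 6 * (spikePosterior c y * (1 - spikePosterior c y))) := by
  rw [iteratedDeriv_succ, iteratedDeriv_three_smoothedLogDensity_spikeInput]
  funext y
  have h := hasDerivAt_spikePosterior (c := c) y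
  rw [(h.fun_mul ((h.const_sub 1).fun_mul ((h.const_mul 2).const_sub 1))).deriv]
  ring

lemma abs_iteratedDeriv_four_smoothedLogDensity_spikeInput_le (y : ℝ) :
    |iteratedDeriv 4 (smoothedLogDensity 1 (spikeInput c)) y| ≤ 1 := by
  rw [iteratedDeriv_four_smoothedLogDensity_spikeInput]
  set q := spikePosterior c y * (1 - spikePosterior c y)
  have hq0 : 0 ≤ q :=
    mul_nonneg (spikePosterior_pos c y).le (sub_nonneg.2 (spikePosterior_lt_one c y).le)
  have hq4 : q ≤ 1 / 4 := by nlinarith [sq_nonneg (2 * spikePosterior c y - 1)]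
  exact abs_le.2 ⟨by nlinarith, by nlinarith⟩

lemma integrable_of_continuous_comp_spikePosterior {g : ℝ → ℝ} (hg : Continuous g)
    {μ : Measure ℝ} [IsFiniteMeasure μ] : Integrable (fun y ↦ g (spikePosterior c y)) μ := by
  obtain ⟨C, hC⟩ := isCompact_Icc.exists_bound_of_continuousOn (s := Set.Icc (0 : ℝ) 1)
    hg.continuousOn
  exact .of_bound (hg.comp continuous_spikePosterior).aestronglyMeasurable C (ae_of_all _ fun y ↦
    hC _ ⟨(spikePosterior_pos c y).le, (spikePosterior_lt_one c y).le⟩)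

lemma integrable_iteratedDeriv_smoothedLogDensity_spikeInput {k : ℕ} (hk : k ≤ 3) :
    Integrable (iteratedDeriv k (smoothedLogDensity 1 (spikeInput c)))
      (spikeInput c ∗ gaussianReal 0 1) := by
  have h2 := memLp_two_conv_gaussianReal (memLp_id_spikeInput (c := c) 2) 0 1
  interval_cases k
  · rw [iteratedDeriv_zero]
    exact integrable_smoothedLogDensity (memLp_id_spikeInput 2) h2
  · rw [iteratedDeriv_one_smoothedLogDensity_spikeInput]
    exact (integrable_of_continuous_comp_spikePosterior continuous_id).sub
      (h2.integrable one_le_two)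
  · rw [iteratedDeriv_two_smoothedLogDensity_spikeInput]
    exact integrable_of_continuous_comp_spikePosterior (g := fun s ↦ s * (1 - s) - 1) (by fun_prop)
  · rw [iteratedDeriv_three_smoothedLogDensity_spikeInput]
    exact integrable_of_continuous_comp_spikePosterior
      (g := fun s ↦ s * ((1 - s) * (1 - 2 * s))) (by fun_prop)

lemma integral_spikePosterior_mul (g : ℝ → ℝ) :
    ∫ y, spikePosterior c y * g y ∂(spikeInput c ∗ gaussianReal 0 1) =
      Real.sigmoid (-c) * ∫ y, g y ∂gaussianReal 1 1 := by
  rw [conv_gaussianReal_eq_withDensity, integral_withDensity_eq_integral_toReal_smul (by fun_prop)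
    (ae_of_all _ fun _ ↦ ENNReal.ofReal_lt_top), integral_gaussianReal_eq_integral_smul one_ne_zero,
    ← integral_const_mul]
  simp_rw [ENNReal.toReal_ofReal (smoothedDensity_pos _).le, smul_eq_mul, ← mul_assoc,
    smoothedDensity_spikeInput_mul_spikePosterior]

lemma integral_spikePosterior_gaussianReal_le :
    ∫ y, spikePosterior c y ∂gaussianReal 1 1 ≤ Real.exp (1 - c) := by
  have hmgf : ∫ y, Real.exp y ∂gaussianReal 1 1 = Real.exp (3 / 2) := by
    have := congrFun (mgf_fun_id_gaussianReal (μ := 1) (v := 1)) 1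
    norm_num [mgf] at this
    exact this
  have hexp : Integrable (fun y ↦ Real.exp y) (gaussianReal 1 1) := by
    simpa using integrable_exp_mul_gaussianReal (μ := 1) (v := 1) 1
  calc ∫ y, spikePosterior c y ∂gaussianReal 1 1
      ≤ ∫ y, Real.exp y * Real.exp (-(c + 1 / 2)) ∂gaussianReal 1 1 := by
        refine integral_mono (integrable_of_continuous_comp_spikePosterior continuous_id)
          (hexp.mul_const _) fun y ↦ (spikePosterior_le_exp c y).trans_eq ?_
        rw [← Real.exp_add, sub_eq_add_neg]
    _ = Real.exp (1 - c) := by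
        rw [integral_mul_const, hmgf, ← Real.exp_add]
        ring_nf

lemma integral_iteratedDeriv_three_smoothedLogDensity_spikeInput_pos
    (hc : 3 * Real.exp (1 - c) < 1) :
    0 < ∫ y, iteratedDeriv 3 (smoothedLogDensity 1 (spikeInput c)) y
      ∂(spikeInput c ∗ gaussianReal 0 1) := by
  rw [iteratedDeriv_three_smoothedLogDensity_spikeInput, integral_spikePosterior_mul]
  refine mul_pos (Real.sigmoid_pos _) ?_
  have hint : Integrable (spikePosterior c) (gaussianReal 1 1) :=
    integrable_of_continuous_comp_spikePosterior continuous_id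
  calc 0 < 1 - 3 * ∫ y, spikePosterior c y ∂gaussianReal 1 1 := by
        linarith [integral_spikePosterior_gaussianReal_le (c := c)]
    _ = ∫ y, (1 - 3 * spikePosterior c y) ∂gaussianReal 1 1 := by
        rw [integral_sub (integrable_const _) (hint.const_mul 3), integral_const_mul]
        simp
    _ ≤ _ := integral_mono ((integrable_const _).sub (hint.const_mul 3))
        (integrable_of_continuous_comp_spikePosterior
          (g := fun s ↦ (1 - s) * (1 - 2 * s)) (by fun_prop))
        fun y ↦ by nlinarith [sq_nonneg (spikePosterior c y)]

end SpikeInput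

section SkewLaw

/-- A centred two-point law of variance `1` and negative third moment; up to scale, the law of the
non-Gaussian input `X₂`. -/
noncomputable abbrev skewLaw : Measure ℝ :=
  bernoulliMeasure (1 / 2) (-2) ⟨4 / 5, by norm_num, by norm_num⟩

lemma memLp_id_skewLaw (p : ℝ≥0) : MemLp id p skewLaw :=
  memLp_id_of_integrable_exp_mul_sq one_pos (integrable_bernoulliMeasure _ _ _ _) p

lemma integral_skewLaw : ∫ x, x ∂skewLaw = 0 := by
  norm_num [integral_bernoulliMeasure]

lemma integral_sq_skewLaw : ∫ x, x ^ 2 ∂skewLaw = 1 := by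
  norm_num [integral_bernoulliMeasure]

lemma integral_cube_skewLaw : ∫ x, x ^ 3 ∂skewLaw = -(3 / 2) := by
  norm_num [integral_bernoulliMeasure]

lemma integral_skewLaw_conv_gaussianReal : ∫ x, x ∂(skewLaw ∗ gaussianReal 0 1) = 0 := by
  have h := integral_pow_conv (n := 1) (μ := skewLaw) (ν := gaussianReal 0 1)
    (by simpa using memLp_id_skewLaw 1) (by simpa using memLp_id_gaussianReal 1)
  simpa [Finset.sum_range_succ, integral_skewLaw] using h

lemma integral_sq_skewLaw_conv_gaussianReal : ∫ x, x ^ 2 ∂(skewLaw ∗ gaussianReal 0 1) = 2 := by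
  rw [integral_pow_conv (memLp_id_skewLaw 2) (memLp_id_gaussianReal 2)]
  norm_num [Finset.sum_range_succ, integral_skewLaw, integral_sq_skewLaw,
    integral_sq_gaussianReal_zero]

lemma integral_cube_skewLaw_conv_gaussianReal :
    ∫ x, x ^ 3 ∂(skewLaw ∗ gaussianReal 0 1) = -(3 / 2) := by
  rw [integral_pow_conv (memLp_id_skewLaw 3) (memLp_id_gaussianReal 3)]
  norm_num [Finset.sum_range_succ, integral_skewLaw, integral_sq_skewLaw, integral_cube_skewLaw,
    integral_pow_gaussianReal_zero_of_odd 1 (show Odd 3 by decide)]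

lemma exists_pos_and_entropyGap_spikeInput_pos :
    ∃ ε : ℝ≥0, 0 < ε ∧ 0 < entropyGap 1 1 (spikeInput 3)
      ((skewLaw ∗ gaussianReal 0 1).map ((ε : ℝ) * ·)) ((gaussianReal 0 1).map ((ε : ℝ) * ·)) := by
  obtain ⟨c, hc, hγ⟩ := exists_integrable_exp_mul_sq_gaussianReal 0 1
  have hexp : 3 * Real.exp (1 - 3) < 1 := by
    calc 3 * Real.exp (1 - 3) = (2 + 1) * Real.exp (-2) := by norm_num
      _ < Real.exp 2 * Real.exp (-2) := by
        gcongr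
        exact Real.add_one_lt_exp two_ne_zero
      _ = 1 := by simp [← Real.exp_add]
  have hα : Integrable (fun x ↦ Real.exp (c / 2 * x ^ 2)) (skewLaw ∗ gaussianReal 0 1) :=
    integrable_exp_mul_sq_conv (by positivity) (integrable_bernoulliMeasure _ _ _ _)
      (by simpa only [mul_div_cancel₀ _ (two_ne_zero' ℝ)] using hγ)
  refine exists_pos_and_entropyGap_map_mul_pos one_pos (memLp_id_spikeInput 2)
    (contDiff_smoothedLogDensity_spikeInput 4)
    abs_iteratedDeriv_four_smoothedLogDensity_spikeInput_le
    (fun k hk ↦ integrable_iteratedDeriv_smoothedLogDensity_spikeInput hk)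
    (integral_iteratedDeriv_three_smoothedLogDensity_spikeInput_pos hexp) (half_pos hc) hα
    integral_skewLaw_conv_gaussianReal ?_ (memLp_id_gaussianReal 4) (by simp) ?_
    (integral_pow_gaussianReal_zero_of_odd 1 (by decide))
  · rw [integral_cube_skewLaw_conv_gaussianReal]
    norm_num
  · rw [integral_sq_skewLaw_conv_gaussianReal, integral_sq_gaussianReal_zero]
    norm_num

lemma secondMoment_skewLaw_map_mul (ε : ℝ≥0) :
    secondMoment (skewLaw.map ((ε : ℝ) * ·)) = (ε ^ 2 : ℝ≥0) := by
  rw [secondMoment_eq_ofReal (memLp_id_map_const_mul (memLp_id_skewLaw 2) ε),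
    integral_map (by fun_prop) (by fun_prop)]
  simp_rw [mul_pow]
  rw [integral_const_mul, integral_sq_skewLaw, mul_one, ← ENNReal.ofReal_coe_nnreal,
    NNReal.coe_pow]

lemma map_mul_conv_gaussianReal_sq (κ : Measure ℝ) [SFinite κ] (ε : ℝ≥0) :
    κ.map ((ε : ℝ) * ·) ∗ gaussianReal 0 (ε ^ 2) = (κ ∗ gaussianReal 0 1).map ((ε : ℝ) * ·) := by
  rw [← gaussianReal_zero_one_map_mul]
  exact (Measure.map_conv_addMonoidHom (AddMonoidHom.mulLeft (ε : ℝ))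
    (measurable_const_mul (ε : ℝ))).symm

lemma exists_mem_zFeasible_zObjective_pos :
    ∃ N S : ℝ≥0, 0 < N ∧ 0 < S ∧ ∃ P ∈ zFeasible N, 0 < zObjective 1 1 N S P := by
  obtain ⟨ε, hε, hgap⟩ := exists_pos_and_entropyGap_spikeInput_pos
  have hκ : IsProbabilityMeasure (skewLaw.map ((ε : ℝ) * ·)) :=
    Measure.isProbabilityMeasure_map (by fun_prop)
  rw [← map_mul_conv_gaussianReal_sq, gaussianReal_zero_one_map_mul] at hgap
  obtain ⟨S, hS, hpos⟩ := exists_pos_and_zObjective_pos (memLp_id_spikeInput 2)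
    (memLp_id_map_const_mul (memLp_id_skewLaw 2) ε) hgap
  exact ⟨ε ^ 2, S, pow_pos hε 2, hS, (spikeInput 3, skewLaw.map ((ε : ℝ) * ·)),
    ⟨inferInstance, hκ, (secondMoment_skewLaw_map_mul ε).le⟩, hpos⟩

end SkewLaw

theorem theorem1 :
    ∃ N₂ A₂ S₁ : ℝ≥0, N₂ = A₂ ∧ 0 < A₂ ∧ 0 < S₁ ∧
      -- the supremum over all admissible inputs is strictly positive
      0 < (⨆ P ∈ zFeasible A₂, zObjective 1 1 N₂ S₁ P) ∧
      -- the supremum over admissible inputs with Gaussian `X₂` (and any `X₁`) is not positive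
      (⨆ P ∈ {P ∈ zFeasible A₂ | IsGaussian P.2}, zObjective 1 1 N₂ S₁ P) ≤ 0 ∧
      -- the maximum is not attained by Gaussian `X₁` and `X₂`
      ¬ ∃ P ∈ zFeasible A₂, IsGaussian P.1 ∧ IsGaussian P.2 ∧
        IsMaxOn (zObjective 1 1 N₂ S₁) (zFeasible A₂) P := by
  obtain ⟨N, S, hN, hS, P, hP, hpos⟩ := exists_mem_zFeasible_zObjective_pos
  have hnonpos : ∀ Q ∈ zFeasible N, IsGaussian Q.2 → zObjective 1 1 N S Q ≤ 0 :=
    fun Q ⟨_, _, hQ⟩ _ ↦ zObjective_nonpos_of_isGaussian le_rfl hS hQ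
  refine ⟨N, N, S, rfl, hN, hS, hpos.trans_le (le_iSup₂_of_le P hP le_rfl),
    iSup₂_le fun Q hQ ↦ hnonpos Q hQ.1 hQ.2, ?_⟩
  rintro ⟨Q, hQ, -, hgauss, hmax⟩
  exact (hpos.trans_le ((hmax hP).trans (hnonpos Q hQ hgauss))).false
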